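/- Let $\mathbf{X}$ be a category and let $|\text{-}|\colon\mathbf{X}\to\mathbf{Set}$ be a topological functor (every structured source $(S\to|Y_i|)_{i\in I}$, of arbitrary size, has a $|\text{-}|$-initial lift). The category $\mathbf{X}\text{-}\mathbf{Equ}$ has as objects the pairs $\langle X,\equiv\rangle$ with $X\in\mathbf{X}$ and $\equiv$ an equivalence relation on $|X|$; its morphisms $\langle X,\equiv\rangle\to\langle Y,\equiv\rangle$ are classes $[f]$ of morphisms $f\colon X\to Y$ of $\mathbf{X}$ such that $x\equiv x'$ implies $|f|(x)\equiv|f|(x')$, where $f$ and $g$ are identified if $x\equiv x'$ implies $|f|(x)\equiv|g|(x')$ for all $x,x'\in|X|$. The exact completion $\mathbf{X}_{\rm ex}$ has as objects the pseudo-equivalence relations $r_1,r_2\colon X_1\rightrightarrows X_0$ in $\mathbf{X}$ (parallel pairs that are reflexive, symmetric and transitive via some morphisms $X_0\to X_1$, $X_1\to X_1$, $X_1\times_{X_0}X_1\to X_1$). A morphism from $r_1,r_2\colon X_1\rightrightarrows X_0$ to $s_1,s_2\colon Y_1\rightrightarrows Y_0$ is a class $[f]$ of morphisms $f\colon X_0\to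 Y_0$ for which there is $g\colon X_1\to Y_1$ with $f r_i=s_i g$ for $i=1,2$, where $f_1,f_2$ are identified if there is $h\colon X_0\to Y_1$ with $f_i=s_i h$ for $i=1,2$. Let $\mathrm{PER}(\mathbf{X},\mathrm{RegMono})$ be the full subcategory of $\mathbf{X}_{\rm ex}$ on those objects for which $\langle r_1,r_2\rangle\colon X_1\to X_0\times X_0$ is a regular monomorphism. Then: 1. The functor sending $\langle X,\equiv\rangle$ to the $|\text{-}|$-initial lift $E_X\rightrightarrows X$ of the two projections $\{(x,x')\mid x\equiv x'\}\rightrightarrows|X|$, and $[f]$ to $[f]$, takes values in $\mathrm{PER}(\mathbf{X},\mathrm{RegMono})$ and is an equivalence of categories $\mathbf{X}\text{-}\mathbf{Equ}\simeq\mathrm{PER}(\mathbf{X},\mathrm{RegMono})$. 2. $\mathbf{X}_{\rm ex}$ has finite limits, and $\mathrm{PER}(\mathbf{X},\mathrm{RegMono})$ is a (full) reflective subcategory of $\mathbf{X}_{\rm ex}$, with a reflector $L$ that preserves finite products. 3. $L$ commutes with change of base in its codomain: for every morphism $f\colon A\to B$ of $\mathrm{PER}(\mathbf{X},\mathrm{RegMono})$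 and every $g\colon Q\to B$ in $\mathbf{X}_{\rm ex}$ with corresponding $\bar g\colon LQ\to B$, $L$ takes the pullback of $g$ along $f$ to the pullback of $\bar g$ along $f$, i.e. $L(f^*Q)\cong f^*(LQ)$ canonically. More generally, $L$ preserves the pullback of any $g\colon Q\to B$ and $g'\colon Q'\to B$ in $\mathbf{X}_{\rm ex}$ with $B\in\mathrm{PER}(\mathbf{X},\mathrm{RegMono})$: if $P=Q\times_B Q'$ in $\mathbf{X}_{\rm ex}$, then $LP=LQ\times_B LQ'$ in $\mathrm{PER}(\mathbf{X},\mathrm{RegMono})$, canonically. -/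

import Mathlib

open CategoryTheory CategoryTheory.Limits

universe u v w

namespace Equilogical

section Topological

variable {X : Type u} [Category.{v} X]

/-- A source `(a i : A ⟶ Y i)` is initial with respect to `U` if every source `(b i : B ⟶ Y i)`
whose underlying maps factor through those of `a` by a map `h` lifts uniquely along `h`. -/
def IsInitialSource (U : X ⥤ Type w) {I : Type*} {A : X} {Y : I → X} (a : ∀ i, A ⟶ Y i) : Prop :=
  ∀ ⦃B : X⦄ (b : ∀ i, B ⟶ Y i) (h : U.obj B ⟶ U.obj A),
    (∀ i, h ≫ U.map (a i) = U.map (b i)) →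
      ∃! k : B ⟶ A, U.map k = h ∧ ∀ i, k ≫ a i = b i

/-- `U : X ⥤ Type w` is a topological functor: every structured source `(s i : S ⟶ U (Y i))`,
of arbitrary (possibly large) size, has an initial lift. The lift is required to lie over `S` up
to a specified bijection. -/
class IsTopological (U : X ⥤ Type w) : Prop where
  exists_initial_lift : ∀ {I : Type (max u v w)} (S : Type w) (Y : I → X)
    (s : ∀ i, S ⟶ U.obj (Y i)), ∃ (A : X) (e : U.obj A ≅ S) (a : ∀ i, A ⟶ Y i),
      (∀ i, U.map (a i) = e.hom ≫ s i) ∧ IsInitialSource U a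

end Topological

section Exact

/-- A pseudo-equivalence relation `r₁, r₂ : rel ⇉ base` in a category. -/
structure PseudoEquivRel (X : Type u) [Category.{v} X] where
  base : X
  rel : X
  r₁ : rel ⟶ base
  r₂ : rel ⟶ base
  refl : ∃ r : base ⟶ rel, r ≫ r₁ = 𝟙 base ∧ r ≫ r₂ = 𝟙 base
  symm : ∃ s : rel ⟶ rel, s ≫ r₁ = r₂ ∧ s ≫ r₂ = r₁
  /-- Transitivity, for all commutative squares `p ≫ r₂ = q ≫ r₁`. When a pullback of `r₂` and `r₁`
  exists this only has to be checked there, see `trans_iff_of_isPullback`. -/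
  trans : ∀ ⦃P : X⦄ (p q : P ⟶ rel), p ≫ r₂ = q ≫ r₁ →
    ∃ t : P ⟶ rel, t ≫ r₁ = p ≫ r₁ ∧ t ≫ r₂ = q ≫ r₂

variable {X : Type u} [Category.{v} X]

/-- Transitivity of a pseudo-equivalence relation may be tested on a pullback. -/
theorem trans_iff_of_isPullback {X₀ X₁ X₂ : X} {r₁ r₂ : X₁ ⟶ X₀} {r₃ r₄ : X₂ ⟶ X₁}
    (h : IsPullback r₃ r₄ r₂ r₁) :
    (∀ ⦃P : X⦄ (p q : P ⟶ X₁), p ≫ r₂ = q ≫ r₁ →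
      ∃ t : P ⟶ X₁, t ≫ r₁ = p ≫ r₁ ∧ t ≫ r₂ = q ≫ r₂) ↔
    ∃ t : X₂ ⟶ X₁, t ≫ r₁ = r₃ ≫ r₁ ∧ t ≫ r₂ = r₄ ≫ r₂ := by
  constructor
  · intro H
    exact H r₃ r₄ h.w
  · rintro ⟨t, h₁, h₂⟩ P p q hpq
    refine ⟨h.lift p q hpq ≫ t, ?_, ?_⟩
    · rw [Category.assoc, h₁, h.lift_fst_assoc]
    · rw [Category.assoc, h₂, h.lift_snd_assoc]

namespace PseudoEquivRel

/-- `f : R.base ⟶ S.base` respects the relations. -/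
def Respects (R S : PseudoEquivRel X) (f : R.base ⟶ S.base) : Prop :=
  ∃ g : R.rel ⟶ S.rel, R.r₁ ≫ f = g ≫ S.r₁ ∧ R.r₂ ≫ f = g ≫ S.r₂

/-- `f₁` and `f₂` represent the same morphism if `(f₁, f₂)` factors through `(S.r₁, S.r₂)`. -/
def homSetoid (R S : PseudoEquivRel X) : Setoid {f : R.base ⟶ S.base // Respects R S f} where
  r f₁ f₂ := ∃ h : R.base ⟶ S.rel, f₁.1 = h ≫ S.r₁ ∧ f₂.1 = h ≫ S.r₂
  iseqv :=
    { refl := by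
        rintro ⟨f, hf⟩
        obtain ⟨r, h₁, h₂⟩ := S.refl
        exact ⟨f ≫ r, by simp [h₁], by simp [h₂]⟩
      symm := by
        rintro f₁ f₂ ⟨h, h₁, h₂⟩
        obtain ⟨s, e₁, e₂⟩ := S.symm
        exact ⟨h ≫ s, by simp [e₁, h₂], by simp [e₂, h₁]⟩
      trans := by
        rintro f₁ f₂ f₃ ⟨h, h₁, h₂⟩ ⟨k, k₁, k₂⟩
        obtain ⟨t, e₁, e₂⟩ := S.trans h k (h₂.symm.trans k₁)
        exact ⟨t, h₁.trans e₁.symm, k₂.trans e₂.symm⟩ }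

theorem respects_id (R : PseudoEquivRel X) : Respects R R (𝟙 R.base) :=
  ⟨𝟙 R.rel, by simp, by simp⟩

theorem Respects.comp {R S T : PseudoEquivRel X} {f : R.base ⟶ S.base} {g : S.base ⟶ T.base}
    (hf : Respects R S f) (hg : Respects S T g) : Respects R T (f ≫ g) := by
  obtain ⟨a, a₁, a₂⟩ := hf
  obtain ⟨b, b₁, b₂⟩ := hg
  refine ⟨a ≫ b, ?_, ?_⟩
  · rw [← Category.assoc, a₁, Category.assoc, b₁, Category.assoc]
  · rw [← Category.assoc, a₂, Category.assoc, b₂, Category.assoc]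

/-- The exact completion of `X`: its objects are the pseudo-equivalence relations in `X`. -/
instance : Category.{v} (PseudoEquivRel X) where
  Hom R S := Quotient (homSetoid R S)
  id R := Quotient.mk _ ⟨𝟙 R.base, respects_id R⟩
  comp {R S T} := Quotient.map₂ (fun f g => ⟨f.1 ≫ g.1, f.2.comp g.2⟩) (by
    rintro f₁ f₂ ⟨h, h₁, h₂⟩ g₁ g₂ ⟨k, k₁, k₂⟩
    obtain ⟨c, c₁, c₂⟩ := g₁.2
    obtain ⟨t, e₁, e₂⟩ := T.trans (h ≫ c) (f₂.1 ≫ k)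
      (by rw [Category.assoc, Category.assoc, ← c₂, ← k₁, h₂, Category.assoc])
    refine ⟨t, ?_, ?_⟩
    · change f₁.1 ≫ g₁.1 = t ≫ T.r₁
      calc f₁.1 ≫ g₁.1 = h ≫ S.r₁ ≫ g₁.1 := by rw [h₁, Category.assoc]
        _ = t ≫ T.r₁ := by rw [c₁, e₁, Category.assoc]
    · change f₂.1 ≫ g₂.1 = t ≫ T.r₂
      rw [e₂, k₂, Category.assoc])
  id_comp := by
    rintro R S ⟨f⟩
    exact congrArg (Quotient.mk _) (Subtype.ext (Category.id_comp _))
  comp_id := by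
    rintro R S ⟨f⟩
    exact congrArg (Quotient.mk _) (Subtype.ext (Category.comp_id _))
  assoc := by
    rintro R S T W ⟨f⟩ ⟨g⟩ ⟨h⟩
    exact congrArg (Quotient.mk _) (Subtype.ext (Category.assoc _ _ _))

end PseudoEquivRel

/-- The exact completion of a category `X` with finite limits. -/
abbrev ExactCompletion (X : Type u) [Category.{v} X] := PseudoEquivRel X

/-- The pseudo-equivalence relations for which `⟨r₁, r₂⟩ : rel ⟶ base × base` is a regular
monomorphism; here `base × base` is any product `(P, p₁, p₂)` of `base` with itself. -/
def PER (X : Type u) [Category.{v} X] : ObjectProperty (ExactCompletion X) := fun R =>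
  ∃ (P : X) (p₁ p₂ : P ⟶ R.base) (m : R.rel ⟶ P), Nonempty (IsLimit (BinaryFan.mk p₁ p₂)) ∧
    m ≫ p₁ = R.r₁ ∧ m ≫ p₂ = R.r₂ ∧ IsRegularMono m

theorem per_iff (R : ExactCompletion X) [HasBinaryProduct R.base R.base] :
    PER X R ↔ IsRegularMono (prod.lift R.r₁ R.r₂) := by
  constructor
  · rintro ⟨P, p₁, p₂, m, ⟨hP⟩, h₁, h₂, hm⟩
    let e := hP.conePointUniqueUpToIso (prodIsProd R.base R.base)
    have e₁ : e.hom ≫ prod.fst = p₁ :=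
      hP.conePointUniqueUpToIso_hom_comp (prodIsProd R.base R.base) ⟨WalkingPair.left⟩
    have e₂ : e.hom ≫ prod.snd = p₂ :=
      hP.conePointUniqueUpToIso_hom_comp (prodIsProd R.base R.base) ⟨WalkingPair.right⟩
    have : prod.lift R.r₁ R.r₂ = m ≫ e.hom := by
      apply Limits.prod.hom_ext
      · rw [prod.lift_fst, Category.assoc, e₁, h₁]
      · rw [prod.lift_snd, Category.assoc, e₂, h₂]
    rw [this]
    exact ((MorphismProperty.regularMono X).cancel_right_of_respectsIso m e.hom).2 hm
  · intro h
    exact ⟨R.base ⨯ R.base, prod.fst, prod.snd, prod.lift R.r₁ R.r₂, ⟨prodIsProd _ _⟩,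
      prod.lift_fst _ _, prod.lift_snd _ _, h⟩

end Exact

section Equ

variable {X : Type u} [Category.{v} X]

/-- Equilogical objects: an object of `X` with an equivalence relation on its underlying set. -/
structure Equ (U : X ⥤ Type w) where
  obj : X
  r : Setoid (U.obj obj)

variable {U : X ⥤ Type w}

namespace Equ

/-- The underlying map of `f` is equivariant. -/
def Equivariant (𝒳 𝒴 : Equ U) (f : 𝒳.obj ⟶ 𝒴.obj) : Prop :=
  ∀ x x' : U.obj 𝒳.obj, 𝒳.r x x' → 𝒴.r (U.map f x) (U.map f x')

/-- The relation identifying two equivariant morphisms. -/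
def homSetoid (𝒳 𝒴 : Equ U) : Setoid {f : 𝒳.obj ⟶ 𝒴.obj // Equivariant 𝒳 𝒴 f} where
  r f g := ∀ x x' : U.obj 𝒳.obj, 𝒳.r x x' → 𝒴.r (U.map f.1 x) (U.map g.1 x')
  iseqv :=
    { refl := fun f => f.2
      symm := fun h x x' hx => 𝒴.r.symm (h x' x (𝒳.r.symm hx))
      trans := fun h k x x' hx => 𝒴.r.trans (h x x' hx) (k x' x' (𝒳.r.refl x')) }

theorem equivariant_id (𝒳 : Equ U) : Equivariant 𝒳 𝒳 (𝟙 𝒳.obj) := by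
  intro x x' h
  simpa using h

theorem Equivariant.comp {𝒳 𝒴 𝒵 : Equ U} {f : 𝒳.obj ⟶ 𝒴.obj} {g : 𝒴.obj ⟶ 𝒵.obj}
    (hf : Equivariant 𝒳 𝒴 f) (hg : Equivariant 𝒴 𝒵 g) : Equivariant 𝒳 𝒵 (f ≫ g) := by
  intro x x' h
  simpa using hg _ _ (hf _ _ h)

/-- The category of equilogical objects. -/
instance : Category.{v} (Equ U) where
  Hom 𝒳 𝒴 := Quotient (homSetoid 𝒳 𝒴)
  id 𝒳 := Quotient.mk _ ⟨𝟙 𝒳.obj, equivariant_id 𝒳⟩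
  comp {𝒳 𝒴 𝒵} := Quotient.map₂ (fun f g => ⟨f.1 ≫ g.1, f.2.comp g.2⟩) (by
    intro f₁ f₂ hf g₁ g₂ hg x x' hx
    simpa using hg _ _ (hf x x' hx))
  id_comp := by
    rintro R S ⟨f⟩
    exact congrArg (Quotient.mk _) (Subtype.ext (Category.id_comp _))
  comp_id := by
    rintro R S ⟨f⟩
    exact congrArg (Quotient.mk _) (Subtype.ext (Category.comp_id _))
  assoc := by
    rintro R S T W ⟨f⟩ ⟨g⟩ ⟨h⟩
    exact congrArg (Quotient.mk _) (Subtype.ext (Category.assoc _ _ _))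

/-- The graph `{(x, x') | x ≡ x'}` of the equivalence relation. -/
abbrev Graph (𝒳 : Equ U) : Type w := {p : U.obj 𝒳.obj × U.obj 𝒳.obj // 𝒳.r p.1 p.2}

/-- An initial lift of the two projections from the graph to the underlying set of `𝒳.obj`. -/
structure GraphLift (𝒳 : Equ U) where
  E : X
  e : U.obj E ≅ 𝒳.Graph
  π₁ : E ⟶ 𝒳.obj
  π₂ : E ⟶ 𝒳.obj
  map_π₁ : ∀ z : U.obj E, U.map π₁ z = (e.hom z).1.1
  map_π₂ : ∀ z : U.obj E, U.map π₂ z = (e.hom z).1.2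
  initial : IsInitialSource U ![π₁, π₂]

theorem nonempty_graphLift [IsTopological U] (𝒳 : Equ U) : Nonempty 𝒳.GraphLift := by
  obtain ⟨A, e, a, ha, hi⟩ := IsTopological.exists_initial_lift (U := U)
    (I := ULift.{max u v w} (Fin 2)) 𝒳.Graph (fun _ => 𝒳.obj)
    (fun i => ![TypeCat.ofHom fun p => p.1.1, TypeCat.ofHom fun p => p.1.2] i.down)
  refine ⟨⟨A, e, a ⟨0⟩, a ⟨1⟩, fun z => ?_, fun z => ?_, ?_⟩⟩
  · rw [ha]; rfl
  · rw [ha]; rfl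
  · intro B b h hb
    obtain ⟨k, ⟨hk, hk'⟩, hu⟩ := hi (fun i => b i.down) h (by
      rintro ⟨i⟩
      fin_cases i
      · exact hb 0
      · exact hb 1)
    refine ⟨k, ⟨hk, fun i => ?_⟩, fun k₂ hk₂ => hu k₂ ⟨hk₂.1, ?_⟩⟩
    · fin_cases i
      · exact hk' ⟨0⟩
      · exact hk' ⟨1⟩
    · rintro ⟨i⟩
      fin_cases i
      · exact hk₂.2 0
      · exact hk₂.2 1

/-- A morphism into the lifted graph amounts to a pair of pointwise equivalent morphisms. -/
theorem GraphLift.exists_lift {𝒳 : Equ U} (G : 𝒳.GraphLift) {B : X} (f g : B ⟶ 𝒳.obj)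
    (h : ∀ b : U.obj B, 𝒳.r (U.map f b) (U.map g b)) :
    ∃ k : B ⟶ G.E, k ≫ G.π₁ = f ∧ k ≫ G.π₂ = g := by
  obtain ⟨k, ⟨_, hk⟩, _⟩ := G.initial ![f, g]
    (TypeCat.ofHom fun b => G.e.inv ⟨(U.map f b, U.map g b), h b⟩) (by
      intro i
      fin_cases i
      · ext b
        simp [G.map_π₁]
      · ext b
        simp [G.map_π₂])
  exact ⟨k, hk 0, hk 1⟩

theorem GraphLift.rel {𝒳 : Equ U} (G : 𝒳.GraphLift) (z : U.obj G.E) :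
    𝒳.r (U.map G.π₁ z) (U.map G.π₂ z) := by
  rw [G.map_π₁, G.map_π₂]
  exact (G.e.hom z).2

variable [IsTopological U]

/-- A choice of the initial lift of the graph. -/
noncomputable def graphLift (𝒳 : Equ U) : 𝒳.GraphLift :=
  Classical.choice 𝒳.nonempty_graphLift

/-- The pseudo-equivalence relation `π₁, π₂ : E ⇉ X` of an equilogical object. -/
noncomputable def toPseudoEquivRel (𝒳 : Equ U) : ExactCompletion X where
  base := 𝒳.obj
  rel := 𝒳.graphLift.E
  r₁ := 𝒳.graphLift.π₁
  r₂ := 𝒳.graphLift.π₂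
  refl := 𝒳.graphLift.exists_lift _ _ fun _ => 𝒳.r.refl _
  symm := 𝒳.graphLift.exists_lift _ _ fun z => 𝒳.r.symm (𝒳.graphLift.rel z)
  trans P p q hpq := 𝒳.graphLift.exists_lift _ _ fun z => by
    have h₁ := 𝒳.graphLift.rel (U.map p z)
    have h₂ := 𝒳.graphLift.rel (U.map q z)
    have h₃ := congrArg (fun k => U.map k z) hpq
    simp only [Functor.map_comp, CategoryTheory.comp_apply] at h₃ ⊢
    rw [h₃] at h₁
    exact 𝒳.r.trans h₁ h₂

variable (U) in
/-- The functor sending an equilogical object to its pseudo-equivalence relation and the class of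
`f` to the class of `f`. -/
noncomputable def toExactCompletion : Equ U ⥤ ExactCompletion X where
  obj 𝒳 := 𝒳.toPseudoEquivRel
  map {𝒳 𝒴} := Quotient.map
    (sa := homSetoid 𝒳 𝒴)
    (sb := PseudoEquivRel.homSetoid 𝒳.toPseudoEquivRel 𝒴.toPseudoEquivRel)
    (fun f => ⟨f.1, by
      obtain ⟨k, h₁, h₂⟩ := 𝒴.graphLift.exists_lift
        (𝒳.graphLift.π₁ ≫ f.1) (𝒳.graphLift.π₂ ≫ f.1)
        (fun z => by simpa using f.2 _ _ (𝒳.graphLift.rel z))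
      exact ⟨k, h₁.symm, h₂.symm⟩⟩)
    (by
      intro f g h
      obtain ⟨k, h₁, h₂⟩ := 𝒴.graphLift.exists_lift f.1 g.1 (fun x => h x x (𝒳.r.refl x))
      exact ⟨k, h₁.symm, h₂.symm⟩)
  map_id _ := rfl
  map_comp := by
    rintro 𝒳 𝒴 𝒵 ⟨f⟩ ⟨g⟩
    rfl

end Equ

end Equ

end Equilogical

namespace Equilogical

section Topological

variable {X : Type u} [Category.{v} X]

/-- Topological functors are faithful. -/
theorem IsTopological.faithful (U : X ⥤ Type w) [IsTopological U] : U.Faithful where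
  map_injective {A B} f g hfg := by
    classical
    by_contra hne
    obtain ⟨C, e, a, ha, hi⟩ := IsTopological.exists_initial_lift (U := U)
      (I := ULift.{max u v w} (Σ P : X × X, P.1 ⟶ P.2)) (U.obj A) (fun _ => B)
      (fun _ => U.map f)
    let b (s : Set (Σ P : X × X, P.1 ⟶ P.2)) (i : ULift.{max u v w} (Σ P : X × X, P.1 ⟶ P.2)) :
        A ⟶ B := if i.down ∈ s then f else g
    have H (s : Set (Σ P : X × X, P.1 ⟶ P.2)) : ∃ k : A ⟶ C, ∀ i, k ≫ a i = b s i := by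
      obtain ⟨k, ⟨_, hk⟩, _⟩ := hi (b s) e.inv (fun i => by
        rw [ha, e.inv_hom_id_assoc]
        by_cases h : i.down ∈ s <;> simp [b, h, hfg])
      exact ⟨k, hk⟩
    choose k hk using H
    refine Function.cantor_injective
      (fun s => (⟨(A, C), k s⟩ : Σ P : X × X, P.1 ⟶ P.2)) fun s t hst => ?_
    have hst' : k s = k t := by simpa using hst
    ext i
    have h : b s ⟨i⟩ = b t ⟨i⟩ := by rw [← hk, ← hk, hst']
    by_cases h₁ : i ∈ s <;> by_cases h₂ : i ∈ t <;> simp_all [b, Ne.symm hne]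

/-- The discrete object on a point. -/
theorem IsTopological.exists_point (U : X ⥤ Type w) [IsTopological U] :
    ∃ (D : X) (d : U.obj D), (∀ ⦃Y : X⦄ (y : U.obj Y), ∃ f : D ⟶ Y, U.map f d = y) ∧
    ∀ ⦃Y : X⦄ (f g : D ⟶ Y), U.map f d = U.map g d → f = g := by
  have := IsTopological.faithful U
  obtain ⟨D, e, a, ha, _⟩ := IsTopological.exists_initial_lift (U := U)
    (I := ULift.{max u v w} (Σ Y : X, U.obj Y)) PUnit (fun i => i.down.1)
    (fun i => TypeCat.ofHom fun _ => i.down.2)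
  refine ⟨D, e.inv PUnit.unit, fun Y y => ⟨a ⟨⟨Y, y⟩⟩, by rw [ha]; rfl⟩, fun Y f g h => ?_⟩
  apply U.map_injective
  rw [← cancel_epi e.inv]
  ext ⟨⟩
  exact h

/-- The indiscrete object on a set. -/
theorem IsTopological.exists_indiscrete (U : X ⥤ Type w) [IsTopological U] (S : Type w) :
    ∃ (C : X) (e : U.obj C ≅ S),
      ∀ ⦃Y : X⦄ (φ : U.obj Y → S), ∃ f : Y ⟶ C, ∀ y, e.hom (U.map f y) = φ y := by
  obtain ⟨C, e, a, ha, hi⟩ := IsTopological.exists_initial_lift (U := U)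
    (I := PEmpty.{max u v w + 1}) S (fun i => i.elim) (fun i => i.elim)
  refine ⟨C, e, fun Y φ => ?_⟩
  obtain ⟨k, ⟨hk, _⟩, _⟩ := hi (B := Y) (fun i => i.elim) (TypeCat.ofHom φ ≫ e.inv)
    (fun i => i.elim)
  exact ⟨k, fun y => by rw [hk]; simp⟩

theorem IsTopological.hasFiniteLimits (U : X ⥤ Type w) [IsTopological U] : HasFiniteLimits X where
  out J _ _ := ⟨fun F => by
    have := IsTopological.faithful U
    obtain ⟨A, e, a, ha, hi⟩ := IsTopological.exists_initial_lift (U := U)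
      (I := ULift.{max u v w} J) (limit (F ⋙ U)) (fun i => F.obj i.down)
      (fun i => limit.π (F ⋙ U) i.down)
    have H (s : Cone F) := hi (fun i => s.π.app i.down)
      (limit.lift (F ⋙ U) (U.mapCone s) ≫ e.inv) (fun i => by simp [ha])
    choose k hk hu using H
    exact ⟨⟨⟨⟨A, { app := fun j => a ⟨j⟩
                   naturality := fun j j' φ => U.map_injective (by
                     have := limit.w (F ⋙ U) φ
                     simp only [Functor.comp_map] at this
                     simp [ha, this]) }⟩,
      { lift := k
        fac := fun s j => (hk s).2 ⟨j⟩
        uniq := fun s m hm => hu s m ⟨by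
          rw [← cancel_mono e.hom, Category.assoc, e.inv_hom_id, Category.comp_id]
          refine limit.hom_ext fun j => ?_
          have h₁ := ha ⟨j⟩
          have h₂ := hm j
          dsimp only at h₁ h₂
          rw [Category.assoc, ← h₁, ← U.map_comp, h₂]
          simp, fun i => hm i.down⟩ }⟩⟩⟩⟩

end Topological

section PER

variable {X : Type u} [Category.{v} X]

/-- The relation induced on the points of the base. -/
def PseudoEquivRel.PointRel (U : X ⥤ Type w) (R : PseudoEquivRel X) (x y : U.obj R.base) : Prop :=
  ∃ z : U.obj R.rel, U.map R.r₁ z = x ∧ U.map R.r₂ z = y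

variable (U : X ⥤ Type w) [IsTopological U]

/-- An object of `PER` represents pointwise related pairs of morphisms. -/
theorem PER.exists_lift {R : ExactCompletion X} (hR : PER X R) {B : X} (f g : B ⟶ R.base)
    (h : ∀ b : U.obj B, R.PointRel U (U.map f b) (U.map g b)) :
    ∃ k : B ⟶ R.rel, k ≫ R.r₁ = f ∧ k ≫ R.r₂ = g := by
  have := IsTopological.faithful U
  obtain ⟨P, p₁, p₂, m, ⟨hP⟩, h₁, h₂, ⟨⟨hm⟩⟩⟩ := hR
  obtain ⟨D, d, hD, hD'⟩ := IsTopological.exists_point U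
  let l : B ⟶ P := hP.lift (BinaryFan.mk f g)
  have l₁ : l ≫ p₁ = f := hP.fac (BinaryFan.mk f g) ⟨WalkingPair.left⟩
  have l₂ : l ≫ p₂ = g := hP.fac (BinaryFan.mk f g) ⟨WalkingPair.right⟩
  have hl : l ≫ hm.left = l ≫ hm.right := by
    apply U.map_injective
    ext b
    obtain ⟨β, hβ⟩ := hD b
    obtain ⟨z, z₁, z₂⟩ := h b
    obtain ⟨ζ, hζ⟩ := hD z
    have e : β ≫ l = ζ ≫ m := by
      apply BinaryFan.IsLimit.hom_ext hP
      · change (β ≫ l) ≫ p₁ = (ζ ≫ m) ≫ p₁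
        rw [Category.assoc, Category.assoc, l₁, h₁]
        apply hD'
        simp [hβ, hζ, z₁]
      · change (β ≫ l) ≫ p₂ = (ζ ≫ m) ≫ p₂
        rw [Category.assoc, Category.assoc, l₂, h₂]
        apply hD'
        simp [hβ, hζ, z₂]
    have e' : β ≫ l ≫ hm.left = β ≫ l ≫ hm.right := by
      rw [reassoc_of% e, reassoc_of% e, hm.w]
    simpa [hβ] using congrArg (fun φ => U.map φ d) e'
  obtain ⟨k, hk⟩ := Fork.IsLimit.lift' hm.isLimit l hl
  change k ≫ m = l at hk
  exact ⟨k, by rw [← h₁, reassoc_of% hk, l₁], by rw [← h₂, reassoc_of% hk, l₂]⟩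

theorem Equ.GraphLift.isRegularMono {𝒳 : Equ U} (G : 𝒳.GraphLift)
    [HasBinaryProduct 𝒳.obj 𝒳.obj] : IsRegularMono (prod.lift G.π₁ G.π₂) := by
  have := IsTopological.faithful U
  obtain ⟨C, e, hC⟩ := IsTopological.exists_indiscrete U (ULift.{w} Prop)
  obtain ⟨χ, hχ⟩ := hC (Y := 𝒳.obj ⨯ 𝒳.obj)
    (fun z => ⟨𝒳.r (U.map prod.fst z) (U.map prod.snd z)⟩)
  obtain ⟨t, ht⟩ := hC (Y := 𝒳.obj ⨯ 𝒳.obj) (fun _ => ⟨True⟩)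
  have key {B : X} (k : B ⟶ 𝒳.obj ⨯ 𝒳.obj) : k ≫ χ = k ≫ t ↔
      ∀ b : U.obj B, 𝒳.r (U.map (k ≫ prod.fst) b) (U.map (k ≫ prod.snd) b) := by
    rw [← U.map_injective.eq_iff, ← cancel_mono e.hom]
    constructor
    · intro h b
      have := congrArg (fun φ => φ b) h
      simpa [hχ, ht] using this
    · intro h
      ext b
      have := h b
      simpa [hχ, ht] using this
  have mono : ∀ {B : X} (f g : B ⟶ G.E), f ≫ G.π₁ = g ≫ G.π₁ → f ≫ G.π₂ = g ≫ G.π₂ → f = g := by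
    intro B f g h₁ h₂
    apply U.map_injective
    rw [← cancel_mono G.e.hom]
    refine ConcreteCategory.hom_ext _ _ fun b => Subtype.ext (Prod.ext ?_ ?_)
    · have h₁' := congrArg (fun φ => U.map φ b) h₁
      simpa [G.map_π₁] using h₁'
    · have h₂' := congrArg (fun φ => U.map φ b) h₂
      simpa [G.map_π₂] using h₂'
  obtain ⟨m, hm⟩ : ∃ m, m = prod.lift G.π₁ G.π₂ := ⟨_, rfl⟩
  have m₁ : m ≫ prod.fst = G.π₁ := by rw [hm]; exact prod.lift_fst _ _
  have m₂ : m ≫ prod.snd = G.π₂ := by rw [hm]; exact prod.lift_snd _ _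
  rw [← hm]
  refine ⟨⟨⟨C, χ, t, (key m).2 fun b => ?_, ?_⟩⟩⟩
  · rw [m₁, m₂]
    exact G.rel b
  · refine Fork.IsLimit.mk' _ fun s => ?_
    choose k h₁ h₂ using G.exists_lift _ _ ((key s.ι).1 s.condition)
    have hk : k ≫ m = s.ι := by
      apply Limits.prod.hom_ext
      · rw [Category.assoc, m₁, h₁]
      · rw [Category.assoc, m₂, h₂]
    refine ⟨k, hk, fun {l} hl => ?_⟩
    change l ≫ m = s.ι at hl
    apply mono
    · rw [← m₁, reassoc_of% hl, reassoc_of% hk]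
    · rw [← m₂, reassoc_of% hl, reassoc_of% hk]

theorem Equ.per_toExactCompletion (𝒳 : Equ U) : PER X ((Equ.toExactCompletion U).obj 𝒳) := by
  have := IsTopological.hasFiniteLimits U
  exact ⟨𝒳.obj ⨯ 𝒳.obj, prod.fst, prod.snd, _, ⟨prodIsProd _ _⟩, prod.lift_fst _ _,
    prod.lift_snd _ _, 𝒳.graphLift.isRegularMono U⟩

end PER

namespace PseudoEquivRel

variable {X : Type u} [Category.{v} X]

/-- The class of a morphism respecting the relations. -/
def homMk {R S : ExactCompletion X} (f : R.base ⟶ S.base) (hf : Respects R S f) : R ⟶ S :=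
  Quotient.mk (homSetoid R S) ⟨f, hf⟩

theorem homMk_surjective {R S : ExactCompletion X} (φ : R ⟶ S) :
    ∃ (f : R.base ⟶ S.base) (hf : Respects R S f), homMk f hf = φ := by
  obtain ⟨⟨f, hf⟩, rfl⟩ := Quotient.exists_rep φ
  exact ⟨f, hf, rfl⟩

theorem homMk_eq_iff {R S : ExactCompletion X} {f g : R.base ⟶ S.base} {hf : Respects R S f}
    {hg : Respects R S g} :
    homMk f hf = homMk g hg ↔ ∃ h : R.base ⟶ S.rel, f = h ≫ S.r₁ ∧ g = h ≫ S.r₂ :=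
  Quotient.eq (r := homSetoid R S)

/-- The pseudo-equivalence relation with only identities. -/
def discrete (A : X) : ExactCompletion X where
  base := A
  rel := A
  r₁ := 𝟙 A
  r₂ := 𝟙 A
  refl := ⟨𝟙 A, by simp, by simp⟩
  symm := ⟨𝟙 A, by simp, by simp⟩
  trans P p q h := ⟨p, rfl, by simpa using h⟩

theorem respects_discrete {A : X} {R : ExactCompletion X} (f : A ⟶ R.base) :
    Respects (discrete A) R f := by
  obtain ⟨r, h₁, h₂⟩ := R.refl
  have e₁ : (f ≫ r) ≫ R.r₁ = f := by simp [h₁]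
  have e₂ : (f ≫ r) ≫ R.r₂ = f := by simp [h₂]
  exact ⟨f ≫ r, (Category.id_comp f).trans e₁.symm, (Category.id_comp f).trans e₂.symm⟩

/-- The class of a morphism out of a discrete pseudo-equivalence relation. -/
def discreteHom {A : X} {R : ExactCompletion X} (f : A ⟶ R.base) : discrete A ⟶ R :=
  homMk (R := discrete A) f (respects_discrete f)

theorem discreteHom_eq_iff {A : X} {R : ExactCompletion X} {f g : A ⟶ R.base} :
    discreteHom (R := R) f = discreteHom g ↔ ∃ h : A ⟶ R.rel, f = h ≫ R.r₁ ∧ g = h ≫ R.r₂ :=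
  homMk_eq_iff (R := discrete A)

theorem discreteHom_surjective {A : X} {R : ExactCompletion X} (φ : discrete A ⟶ R) :
    ∃ f : A ⟶ R.base, discreteHom f = φ := by
  obtain ⟨f, _, rfl⟩ := homMk_surjective φ
  exact ⟨f, rfl⟩

/-- The discrete pseudo-equivalence relation on a terminal object is terminal. -/
theorem nonempty_isTerminal_discrete {A : X} (hA : IsTerminal A) :
    Nonempty (IsTerminal (discrete A)) := by
  refine ⟨IsTerminal.ofUniqueHom (fun R => homMk (S := discrete A) (hA.from R.base)
    ⟨hA.from _, hA.hom_ext _ _, hA.hom_ext _ _⟩) fun R φ => ?_⟩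
  obtain ⟨f, hf, rfl⟩ := homMk_surjective φ
  exact homMk_eq_iff.2 ⟨hA.from _, hA.hom_ext _ _, hA.hom_ext _ _⟩

theorem per_discrete_of_isTerminal {A : X} (hA : IsTerminal A) : PER X (discrete A) :=
  ⟨A, 𝟙 A, 𝟙 A, 𝟙 A, ⟨BinaryFan.IsLimit.mk _ (fun f _ => f) (fun _ _ => hA.hom_ext _ _)
    (fun _ _ => hA.hom_ext _ _) (fun _ _ _ _ _ => hA.hom_ext _ _)⟩,
    Category.id_comp _, Category.id_comp _,
    MorphismProperty.id_mem (MorphismProperty.regularMono X) A⟩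

section Pullback

variable [HasFiniteLimits X]

/-- The generic cone of a pair of morphisms with a homotopy between its images. -/
theorem exists_homotopyPullback {A A' B₀ B₁ : X} (s₁ s₂ : B₁ ⟶ B₀) (g : A ⟶ B₀) (g' : A' ⟶ B₀) :
    ∃ (P : X) (p : P ⟶ A) (p' : P ⟶ A') (z : P ⟶ B₁), p ≫ g = z ≫ s₁ ∧ p' ≫ g' = z ≫ s₂ ∧
      ∀ ⦃T : X⦄ (f : T ⟶ A) (f' : T ⟶ A') (h : T ⟶ B₁), f ≫ g = h ≫ s₁ → f' ≫ g' = h ≫ s₂ →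
        ∃ k : T ⟶ P, k ≫ p = f ∧ k ≫ p' = f' := by
  have w := pullback.condition (f := prod.map g g') (g := prod.lift s₁ s₂)
  refine ⟨pullback (prod.map g g') (prod.lift s₁ s₂), pullback.fst _ _ ≫ prod.fst,
    pullback.fst _ _ ≫ prod.snd, pullback.snd _ _, ?_, ?_, fun T f f' h e e' => ?_⟩
  · simpa [prod.lift_fst] using w =≫ prod.fst
  · simpa [prod.lift_snd] using w =≫ prod.snd
  · exact ⟨pullback.lift (prod.lift f f') h (by
      ext <;> simp [prod.lift_fst, prod.lift_snd, e, e']),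
      by rw [pullback.lift_fst_assoc, prod.lift_fst], by rw [pullback.lift_fst_assoc, prod.lift_snd]⟩

/-- The generic pair of morphisms to `P` with homotopies between the images in `A` and in `A'`. -/
theorem exists_doubleHomotopy {P A A' R R' : X} (x : P ⟶ A) (x' : P ⟶ A') (r₁ r₂ : R ⟶ A)
    (r₁' r₂' : R' ⟶ A') :
    ∃ (E : X) (e₁ e₂ : E ⟶ P) (a : E ⟶ R) (a' : E ⟶ R'),
      (e₁ ≫ x = a ≫ r₁ ∧ e₂ ≫ x = a ≫ r₂ ∧ e₁ ≫ x' = a' ≫ r₁' ∧ e₂ ≫ x' = a' ≫ r₂') ∧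
      ∀ ⦃T : X⦄ (f₁ f₂ : T ⟶ P) (b : T ⟶ R) (b' : T ⟶ R'),
        f₁ ≫ x = b ≫ r₁ → f₂ ≫ x = b ≫ r₂ → f₁ ≫ x' = b' ≫ r₁' → f₂ ≫ x' = b' ≫ r₂' →
        ∃ k : T ⟶ E, k ≫ e₁ = f₁ ∧ k ≫ e₂ = f₂ := by
  let F : P ⨯ P ⟶ (A ⨯ A) ⨯ (A' ⨯ A') := prod.lift (prod.map x x) (prod.map x' x')
  let G : R ⨯ R' ⟶ (A ⨯ A) ⨯ (A' ⨯ A') := prod.map (prod.lift r₁ r₂) (prod.lift r₁' r₂')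
  have w := pullback.condition (f := F) (g := G)
  refine ⟨pullback F G, pullback.fst _ _ ≫ prod.fst, pullback.fst _ _ ≫ prod.snd,
    pullback.snd _ _ ≫ prod.fst, pullback.snd _ _ ≫ prod.snd, ⟨?_, ?_, ?_, ?_⟩,
    fun T f₁ f₂ b b' h₁ h₂ h₁' h₂' => ?_⟩
  · simpa [F, G, prod.lift_fst, prod.lift_fst_assoc] using w =≫ (prod.fst ≫ prod.fst)
  · simpa [F, G, prod.lift_snd, prod.lift_fst_assoc] using w =≫ (prod.fst ≫ prod.snd)
  · simpa [F, G, prod.lift_fst, prod.lift_snd_assoc] using w =≫ (prod.snd ≫ prod.fst)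
  · simpa [F, G, prod.lift_snd, prod.lift_snd_assoc] using w =≫ (prod.snd ≫ prod.snd)
  · exact ⟨pullback.lift (prod.lift f₁ f₂) (prod.lift b b')
      (by ext <;> simp [F, G, prod.lift_fst, prod.lift_snd, h₁, h₂, h₁', h₂']),
      by rw [pullback.lift_fst_assoc, prod.lift_fst],
      by rw [pullback.lift_fst_assoc, prod.lift_snd]⟩

theorem exists_isPullback {Q Q' B : ExactCompletion X} (g : Q ⟶ B) (g' : Q' ⟶ B) :
    ∃ (P : ExactCompletion X) (p : P ⟶ Q) (q : P ⟶ Q'), IsPullback p q g g' := by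
  obtain ⟨g, hg, rfl⟩ := homMk_surjective g
  obtain ⟨g', hg', rfl⟩ := homMk_surjective g'
  obtain ⟨P₀, x, x', z, hx, hx', hP₀⟩ := exists_homotopyPullback B.r₁ B.r₂ g g'
  obtain ⟨P₁, e₁, e₂, a, a', ⟨h₁, h₂, h₁', h₂'⟩, hP₁⟩ :=
    exists_doubleHomotopy x x' Q.r₁ Q.r₂ Q'.r₁ Q'.r₂
  let P : ExactCompletion X :=
    { base := P₀
      rel := P₁
      r₁ := e₁
      r₂ := e₂
      refl := by
        obtain ⟨r, hr₁, hr₂⟩ := Q.refl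
        obtain ⟨r', hr₁', hr₂'⟩ := Q'.refl
        exact hP₁ (𝟙 _) (𝟙 _) (x ≫ r) (x' ≫ r') (by simp [hr₁]) (by simp [hr₂])
          (by simp [hr₁']) (by simp [hr₂'])
      symm := by
        obtain ⟨r, hr₁, hr₂⟩ := Q.symm
        obtain ⟨r', hr₁', hr₂'⟩ := Q'.symm
        exact hP₁ e₂ e₁ (a ≫ r) (a' ≫ r') (by simp [hr₁, h₂]) (by simp [hr₂, h₁])
          (by simp [hr₁', h₂']) (by simp [hr₂', h₁'])
      trans := by
        intro T p q hpq
        obtain ⟨t, ht₁, ht₂⟩ := Q.trans (p ≫ a) (q ≫ a)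
          (by rw [Category.assoc, Category.assoc, ← h₁, ← h₂, reassoc_of% hpq])
        obtain ⟨t', ht₁', ht₂'⟩ := Q'.trans (p ≫ a') (q ≫ a')
          (by rw [Category.assoc, Category.assoc, ← h₁', ← h₂', reassoc_of% hpq])
        exact hP₁ (p ≫ e₁) (q ≫ e₂) t t' (by simp [ht₁, h₁]) (by simp [ht₂, h₂])
          (by simp [ht₁', h₁']) (by simp [ht₂', h₂']) }
  refine ⟨P, homMk (R := P) x ⟨a, h₁, h₂⟩, homMk (R := P) x' ⟨a', h₁', h₂'⟩, IsPullback.mk' ?_ ?_ ?_⟩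
  · exact homMk_eq_iff.2 ⟨z, hx, hx'⟩
  · intro T φ φ' h h'
    obtain ⟨φ, hφ, rfl⟩ := homMk_surjective φ
    obtain ⟨φ', hφ', rfl⟩ := homMk_surjective φ'
    obtain ⟨b, hb₁, hb₂⟩ := homMk_eq_iff.1 h
    obtain ⟨b', hb₁', hb₂'⟩ := homMk_eq_iff.1 h'
    obtain ⟨k, hk₁, hk₂⟩ := hP₁ φ φ' b b' hb₁ hb₂ hb₁' hb₂'
    exact homMk_eq_iff.2 ⟨k, hk₁.symm, hk₂.symm⟩
  · intro T f f' h
    obtain ⟨f, ⟨b, hb₁, hb₂⟩, rfl⟩ := homMk_surjective f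
    obtain ⟨f', ⟨b', hb₁', hb₂'⟩, rfl⟩ := homMk_surjective f'
    obtain ⟨c, hc₁, hc₂⟩ := homMk_eq_iff.1 h
    obtain ⟨k, rfl, rfl⟩ := hP₀ f f' c hc₁ hc₂
    obtain ⟨l, hl₁, hl₂⟩ := hP₁ (T.r₁ ≫ k) (T.r₂ ≫ k) b b' (by simpa using hb₁)
      (by simpa using hb₂) (by simpa using hb₁') (by simpa using hb₂')
    exact ⟨homMk (S := P) k ⟨l, hl₁.symm, hl₂.symm⟩, rfl, rfl⟩

theorem hasFiniteLimits : HasFiniteLimits (ExactCompletion X) := by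
  obtain ⟨h⟩ := nonempty_isTerminal_discrete (terminalIsTerminal (C := X))
  have : HasTerminal (ExactCompletion X) := h.hasTerminal
  have : HasPullbacks (ExactCompletion X) :=
    have (Q Q' B : ExactCompletion X) (g : Q ⟶ B) (g' : Q' ⟶ B) : HasLimit (cospan g g') := by
      obtain ⟨P, p, q, hP⟩ := exists_isPullback g g'
      exact hP.hasPullback
    hasPullbacks_of_hasLimit_cospan _
  exact hasFiniteLimits_of_hasTerminal_and_pullbacks

end Pullback

end PseudoEquivRel

variable {X : Type u} [Category.{v} X]

theorem map_comp_point (U : X ⥤ Type w) {A B C : X} (f : A ⟶ B) (g : B ⟶ C) (x : U.obj A) :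
    U.map (f ≫ g) x = U.map g (U.map f x) := by
  simp

namespace Equ

variable {U : X ⥤ Type w}

theorem GraphLift.exists_lift_iff {𝒳 : Equ U} (G : 𝒳.GraphLift) {A : X} (f g : A ⟶ 𝒳.obj) :
    (∃ k : A ⟶ G.E, f = k ≫ G.π₁ ∧ g = k ≫ G.π₂) ↔
      ∀ x : U.obj A, 𝒳.r (U.map f x) (U.map g x) := by
  constructor
  · rintro ⟨k, rfl, rfl⟩ x
    rw [map_comp_point, map_comp_point]
    exact G.rel _
  · intro h
    obtain ⟨k, h₁, h₂⟩ := G.exists_lift f g h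
    exact ⟨k, h₁.symm, h₂.symm⟩

/-- The class of an equivariant morphism. -/
def homMk {𝒳 𝒴 : Equ U} (f : 𝒳.obj ⟶ 𝒴.obj) (hf : Equivariant 𝒳 𝒴 f) : 𝒳 ⟶ 𝒴 :=
  Quotient.mk (homSetoid 𝒳 𝒴) ⟨f, hf⟩

theorem homMk_surjective {𝒳 𝒴 : Equ U} (φ : 𝒳 ⟶ 𝒴) :
    ∃ (f : 𝒳.obj ⟶ 𝒴.obj) (hf : Equivariant 𝒳 𝒴 f), homMk f hf = φ := by
  obtain ⟨⟨f, hf⟩, rfl⟩ := Quotient.exists_rep φ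
  exact ⟨f, hf, rfl⟩

theorem homMk_eq_iff {𝒳 𝒴 : Equ U} {f g : 𝒳.obj ⟶ 𝒴.obj} {hf : Equivariant 𝒳 𝒴 f}
    {hg : Equivariant 𝒳 𝒴 g} :
    homMk f hf = homMk g hg ↔ ∀ x : U.obj 𝒳.obj, 𝒴.r (U.map f x) (U.map g x) :=
  (Quotient.eq (r := homSetoid 𝒳 𝒴)).trans ⟨fun h x => h x x (𝒳.r.refl x),
    fun h x x' hx => 𝒴.r.trans (hf x x' hx) (h x')⟩

end Equ

namespace PseudoEquivRel

variable (U : X ⥤ Type w)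

theorem PointRel.map {R S : ExactCompletion X} {f : R.base ⟶ S.base} (hf : Respects R S f)
    {x y : U.obj R.base} (h : R.PointRel U x y) : S.PointRel U (U.map f x) (U.map f y) := by
  obtain ⟨g, h₁, h₂⟩ := hf
  obtain ⟨z, rfl, rfl⟩ := h
  refine ⟨U.map g z, ?_, ?_⟩
  · simpa using (congrArg (fun φ => U.map φ z) h₁).symm
  · simpa using (congrArg (fun φ => U.map φ z) h₂).symm

theorem pointRel_comp {S : ExactCompletion X} {A : X} (h : A ⟶ S.rel) (x : U.obj A) :
    S.PointRel U (U.map (h ≫ S.r₁) x) (U.map (h ≫ S.r₂) x) :=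
  ⟨U.map h x, by simp, by simp⟩

theorem pointRel_of_discreteHom_eq {S : ExactCompletion X} {A : X} {f g : A ⟶ S.base}
    (h : discreteHom (R := S) f = discreteHom g) (x : U.obj A) :
    S.PointRel U (U.map f x) (U.map g x) := by
  obtain ⟨k, rfl, rfl⟩ := discreteHom_eq_iff.1 h
  exact pointRel_comp U k x

variable [IsTopological U]

/-- Points of `R` are related if and only if they agree as morphisms of the exact completion. -/
theorem exists_point : ∃ (D : X) (d : U.obj D),
    (∀ ⦃Y : X⦄ (y : U.obj Y), ∃ f : D ⟶ Y, U.map f d = y) ∧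
    ∀ ⦃R : ExactCompletion X⦄ (f g : D ⟶ R.base),
      R.PointRel U (U.map f d) (U.map g d) ↔ discreteHom (R := R) f = discreteHom g := by
  obtain ⟨D, d, hD, hD'⟩ := IsTopological.exists_point U
  refine ⟨D, d, hD, fun R f g => ⟨?_, fun h => pointRel_of_discreteHom_eq U h d⟩⟩
  rintro ⟨z, h₁, h₂⟩
  obtain ⟨ζ, rfl⟩ := hD z
  exact discreteHom_eq_iff.2 ⟨ζ, hD' _ _ (by simp [h₁]), hD' _ _ (by simp [h₂])⟩

theorem equivalence_pointRel (R : ExactCompletion X) : Equivalence (R.PointRel U) := by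
  obtain ⟨D, d, hD, hR⟩ := exists_point U
  refine ⟨fun x => ?_, fun {x y} h => ?_, fun {x y z} h h' => ?_⟩
  · obtain ⟨f, rfl⟩ := hD x
    exact (hR f f).2 rfl
  · obtain ⟨f, rfl⟩ := hD x
    obtain ⟨g, rfl⟩ := hD y
    exact (hR g f).2 ((hR f g).1 h).symm
  · obtain ⟨f, rfl⟩ := hD x
    obtain ⟨g, rfl⟩ := hD y
    obtain ⟨k, rfl⟩ := hD z
    exact (hR f k).2 (((hR f g).1 h).trans ((hR g k).1 h'))

/-- The equilogical object of a pseudo-equivalence relation: the relation on points is the image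
of the pseudo-equivalence relation. -/
def toEqu : ExactCompletion X ⥤ Equ U where
  obj R := ⟨R.base, ⟨R.PointRel U, equivalence_pointRel U R⟩⟩
  map {R S} := Quotient.map (sa := homSetoid R S)
    (sb := Equ.homSetoid ⟨R.base, ⟨R.PointRel U, equivalence_pointRel U R⟩⟩
      ⟨S.base, ⟨S.PointRel U, equivalence_pointRel U S⟩⟩)
    (fun f => ⟨f.1, fun _ _ h => h.map U f.2⟩) (by
      rintro ⟨f, hf⟩ ⟨g, hg⟩ ⟨h, h₁, h₂⟩ x x' hx
      dsimp only at h₁ h₂ ⊢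
      refine (equivalence_pointRel U S).trans (PointRel.map U hf hx) ?_
      subst h₁ h₂
      exact pointRel_comp U h x')
  map_id _ := rfl
  map_comp := by
    rintro R S T ⟨f⟩ ⟨g⟩
    rfl

theorem equivariant_toEqu_iff (R : ExactCompletion X) (𝒴 : Equ U) (f : R.base ⟶ 𝒴.obj) :
    Equ.Equivariant ((toEqu U).obj R) 𝒴 f ↔
      Respects R ((Equ.toExactCompletion U).obj 𝒴) f := by
  refine Iff.trans ?_ (𝒴.graphLift.exists_lift_iff (R.r₁ ≫ f) (R.r₂ ≫ f)).symm
  simp only [map_comp_point]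
  constructor
  · exact fun h z => h _ _ ⟨z, rfl, rfl⟩
  · rintro h _ _ ⟨z, rfl, rfl⟩
    exact h z

theorem homSetoid_toEqu_iff (R : ExactCompletion X) (𝒴 : Equ U) (f g : R.base ⟶ 𝒴.obj)
    (hf : Equ.Equivariant ((toEqu U).obj R) 𝒴 f) (hg : Equ.Equivariant ((toEqu U).obj R) 𝒴 g) :
    Equ.homSetoid ((toEqu U).obj R) 𝒴 ⟨f, hf⟩ ⟨g, hg⟩ ↔
      homSetoid R ((Equ.toExactCompletion U).obj 𝒴) ⟨f, (equivariant_toEqu_iff U R 𝒴 f).1 hf⟩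
        ⟨g, (equivariant_toEqu_iff U R 𝒴 g).1 hg⟩ := by
  exact Quotient.eq.symm.trans
    (Equ.homMk_eq_iff.trans (𝒴.graphLift.exists_lift_iff f g).symm)

/-- `toEqu` is left adjoint to `toExactCompletion`. -/
noncomputable def toEquAdjunction : toEqu U ⊣ Equ.toExactCompletion U :=
  Adjunction.mkOfHomEquiv
    { homEquiv := fun R 𝒴 => Quotient.congr
        (ra := Equ.homSetoid ((toEqu U).obj R) 𝒴)
        (rb := homSetoid R ((Equ.toExactCompletion U).obj 𝒴))
        (Equiv.subtypeEquivRight (equivariant_toEqu_iff U R 𝒴))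
        (fun f g => homSetoid_toEqu_iff U R 𝒴 f.1 g.1 f.2 g.2)
      homEquiv_naturality_left_symm := by
        rintro R S 𝒴 ⟨f⟩ ⟨g⟩
        rfl
      homEquiv_naturality_right := by
        rintro R 𝒴 𝒵 ⟨f⟩ ⟨g⟩
        rfl }

theorem pointRel_toExactCompletion (𝒳 : Equ U) (x y : U.obj 𝒳.obj) :
    ((Equ.toExactCompletion U).obj 𝒳).PointRel U x y ↔ 𝒳.r x y := by
  constructor
  · rintro ⟨z, rfl, rfl⟩
    exact 𝒳.graphLift.rel z
  · intro h
    refine ⟨𝒳.graphLift.e.inv ⟨(x, y), h⟩, (𝒳.graphLift.map_π₁ _).trans ?_,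
      (𝒳.graphLift.map_π₂ _).trans ?_⟩ <;> simp

instance faithful_toExactCompletion : (Equ.toExactCompletion U).Faithful where
  map_injective {𝒳 𝒴} φ ψ h := by
    obtain ⟨f, hf, rfl⟩ := Equ.homMk_surjective φ
    obtain ⟨g, hg, rfl⟩ := Equ.homMk_surjective ψ
    obtain ⟨k, e₁, e₂⟩ := homMk_eq_iff.1 h
    exact Equ.homMk_eq_iff.2 ((𝒴.graphLift.exists_lift_iff f g).1 ⟨k, e₁, e₂⟩)

instance full_toExactCompletion : (Equ.toExactCompletion U).Full where
  map_surjective {𝒳 𝒴} φ := by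
    obtain ⟨f, hf, rfl⟩ := homMk_surjective φ
    exact ⟨Equ.homMk f fun x x' hx => (pointRel_toExactCompletion U 𝒴 _ _).1
      (((pointRel_toExactCompletion U 𝒳 _ _).2 hx).map U hf), rfl⟩

end PseudoEquivRel

/-- An object of `PER` is isomorphic to the lift of its relation on points. -/
theorem PER.nonempty_iso (U : X ⥤ Type w) [IsTopological U] {R : ExactCompletion X} (hR : PER X R) :
    Nonempty ((Equ.toExactCompletion U).obj ((PseudoEquivRel.toEqu U).obj R) ≅ R) := by
  obtain ⟨k, h₁, h₂⟩ := hR.exists_lift U ((PseudoEquivRel.toEqu U).obj R).graphLift.π₁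
    ((PseudoEquivRel.toEqu U).obj R).graphLift.π₂ ((PseudoEquivRel.toEqu U).obj R).graphLift.rel
  obtain ⟨l, e₁, e₂⟩ := (PseudoEquivRel.equivariant_toEqu_iff U R _ _).1
    (Equ.equivariant_id ((PseudoEquivRel.toEqu U).obj R))
  let S := (Equ.toExactCompletion U).obj ((PseudoEquivRel.toEqu U).obj R)
  exact ⟨PseudoEquivRel.homMk (R := S) (𝟙 R.base) ⟨k, (Category.comp_id _).trans h₁.symm,
    (Category.comp_id _).trans h₂.symm⟩, PseudoEquivRel.homMk (S := S) (𝟙 R.base) ⟨l, e₁, e₂⟩,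
    congrArg (Quotient.mk _) (Subtype.ext (Category.comp_id _)),
    congrArg (Quotient.mk _) (Subtype.ext (Category.comp_id _))⟩

namespace PseudoEquivRel

variable (U : X ⥤ Type w) [IsTopological U]

instance isEquivalence_lift_toExactCompletion :
    ((PER X).lift (Equ.toExactCompletion U) (Equ.per_toExactCompletion U)).IsEquivalence where
  faithful := inferInstance
  full := inferInstance
  essSurj := ⟨fun R => ⟨(toEqu U).obj R.obj, by
    obtain ⟨e⟩ := R.property.nonempty_iso U
    exact ⟨(PER X).isoMk e⟩⟩⟩

/-- `toEqu` preserves pullbacks over objects of `PER`. -/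
theorem isPullback_toEqu_map {P Q Q' B : ExactCompletion X} (hB : PER X B) {p : P ⟶ Q}
    {q : P ⟶ Q'} {g : Q ⟶ B} {g' : Q' ⟶ B} (h : IsPullback p q g g') :
    IsPullback ((toEqu U).map p) ((toEqu U).map q) ((toEqu U).map g) ((toEqu U).map g') := by
  obtain ⟨p, hp, rfl⟩ := homMk_surjective p
  obtain ⟨q, hq, rfl⟩ := homMk_surjective q
  obtain ⟨g, hg, rfl⟩ := homMk_surjective g
  obtain ⟨g', hg', rfl⟩ := homMk_surjective g'
  have rel {A : X} (k l : A ⟶ P.base) (x y : U.obj A)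
      (h₁ : Q.PointRel U (U.map (k ≫ p) x) (U.map (l ≫ p) y))
      (h₂ : Q'.PointRel U (U.map (k ≫ q) x) (U.map (l ≫ q) y)) :
      P.PointRel U (U.map k x) (U.map l y) := by
    obtain ⟨D, d, hD, hR⟩ := exists_point U
    obtain ⟨x, rfl⟩ := hD x
    obtain ⟨y, rfl⟩ := hD y
    simp only [← map_comp_point, ← Category.assoc] at h₁ h₂ ⊢
    rw [hR] at h₁ h₂ ⊢
    exact h.hom_ext h₁ h₂
  refine IsPullback.mk' ?_ ?_ ?_
  · rw [← Functor.map_comp, h.w, Functor.map_comp]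
  · intro T φ φ' h₁ h₂
    obtain ⟨φ, hφ, rfl⟩ := Equ.homMk_surjective φ
    obtain ⟨φ', hφ', rfl⟩ := Equ.homMk_surjective φ'
    exact Equ.homMk_eq_iff.2 fun x => rel φ φ' x x (Equ.homMk_eq_iff.1 h₁ x)
      (Equ.homMk_eq_iff.1 h₂ x)
  · intro T a b hab
    obtain ⟨a, ha, rfl⟩ := Equ.homMk_surjective a
    obtain ⟨b, hb, rfl⟩ := Equ.homMk_surjective b
    obtain ⟨z, hz₁, hz₂⟩ := hB.exists_lift U (a ≫ g) (b ≫ g') (Equ.homMk_eq_iff.1 hab)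
    obtain ⟨k, hk₁, hk₂⟩ := h.exists_lift (discreteHom (R := Q) a) (discreteHom (R := Q') b)
      (discreteHom_eq_iff.2 ⟨z, hz₁.symm, hz₂.symm⟩)
    obtain ⟨k, rfl⟩ := discreteHom_surjective k
    have e₁ := pointRel_of_discreteHom_eq U hk₁
    have e₂ := pointRel_of_discreteHom_eq U hk₂
    have hQ := equivalence_pointRel U Q
    have hQ' := equivalence_pointRel U Q'
    exact ⟨Equ.homMk (𝒴 := (toEqu U).obj P) k fun x y hxy => rel k k x y
      (hQ.trans (hQ.trans (e₁ x) (ha x y hxy)) (hQ.symm (e₁ y)))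
      (hQ'.trans (hQ'.trans (e₂ x) (hb x y hxy)) (hQ'.symm (e₂ y))),
      Equ.homMk_eq_iff.2 e₁, Equ.homMk_eq_iff.2 e₂⟩

end PseudoEquivRel

/-- A functor preserves finite products if it preserves a terminal object and pullbacks over it. -/
theorem preservesFiniteProducts_of_isPullback {C D : Type*} [Category* C] [Category* D]
    [HasFiniteLimits C] (F : C ⥤ D) {T : C} (hT : IsTerminal T) (hFT : IsTerminal (F.obj T))
    (h : ∀ ⦃P Q Q' : C⦄ (p : P ⟶ Q) (q : P ⟶ Q') (g : Q ⟶ T) (g' : Q' ⟶ T),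
      IsPullback p q g g' → IsPullback (F.map p) (F.map q) (F.map g) (F.map g')) :
    PreservesFiniteProducts F := by
  have : PreservesLimitsOfShape (Discrete.{0} PEmpty) F := by
    have : PreservesLimit (Functor.empty.{0} C) F :=
      preservesLimit_of_preserves_limit_cone hT ((isLimitMapConeEmptyConeEquiv F T).symm hFT)
    exact preservesLimitsOfShape_pempty_of_preservesTerminal F
  have : PreservesLimitsOfShape (Discrete WalkingPair) F :=
    ⟨fun {K} => by
      have : PreservesLimit (pair (K.obj ⟨.left⟩) (K.obj ⟨.right⟩)) F := by
        refine preservesLimit_of_preserves_limit_cone (prodIsProd _ _)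
          ((isLimitMapConeBinaryFanEquiv F _ _).symm ?_)
        exact isProductOfIsTerminalIsPullback _ _ _ _ hFT
          (h _ _ _ _ (IsPullback.of_is_product' (prodIsProd _ _) hT)).isLimit
      exact preservesLimit_of_iso_diagram F (diagramIsoPair K).symm⟩
  exact PreservesFiniteProducts.of_preserves_binary_and_terminal F

end Equilogical

open Equilogical

theorem mainTheorem6 {X : Type u} [Category.{v} X] (U : X ⥤ Type w)
    [Equilogical.IsTopological U] :
    (∃ h : ∀ 𝒳 : Equilogical.Equ U,
        Equilogical.PER X ((Equilogical.Equ.toExactCompletion U).obj 𝒳),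
      ((Equilogical.PER X).lift (Equilogical.Equ.toExactCompletion U) h).IsEquivalence) ∧
    HasFiniteLimits (Equilogical.ExactCompletion X) ∧
    ∃ (L : Equilogical.ExactCompletion X ⥤ (Equilogical.PER X).FullSubcategory)
      (adj : L ⊣ (Equilogical.PER X).ι),
      PreservesFiniteProducts L ∧
      (∀ (A B : (Equilogical.PER X).FullSubcategory) (f : A ⟶ B)
        (P Q : Equilogical.ExactCompletion X) (g : Q ⟶ (Equilogical.PER X).ι.obj B)
        (p : P ⟶ Q) (q : P ⟶ (Equilogical.PER X).ι.obj A),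
        IsPullback p q g ((Equilogical.PER X).ι.map f) →
          IsPullback (L.map p) ((adj.homEquiv P A).symm q) ((adj.homEquiv Q B).symm g) f) ∧
      (∀ (B : (Equilogical.PER X).FullSubcategory) (P Q Q' : Equilogical.ExactCompletion X)
        (g : Q ⟶ (Equilogical.PER X).ι.obj B) (g' : Q' ⟶ (Equilogical.PER X).ι.obj B)
        (p : P ⟶ Q) (q : P ⟶ Q'),
        IsPullback p q g g' →
          IsPullback (L.map p) (L.map q)
            ((adj.homEquiv Q B).symm g) ((adj.homEquiv Q' B).symm g')) := by
  have := IsTopological.hasFiniteLimits U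
  have hlim : HasFiniteLimits (ExactCompletion X) := PseudoEquivRel.hasFiniteLimits
  refine ⟨⟨Equ.per_toExactCompletion U, inferInstance⟩, hlim, ?_⟩
  let K := (PER X).lift (Equ.toExactCompletion U) (Equ.per_toExactCompletion U)
  have : K.IsEquivalence := PseudoEquivRel.isEquivalence_lift_toExactCompletion U
  let L := PseudoEquivRel.toEqu U ⋙ K
  let i : K.inv ⋙ Equ.toExactCompletion U ≅ (PER X).ι :=
    Functor.isoWhiskerRight K.asEquivalence.counitIso (PER X).ι
  let adj : L ⊣ (PER X).ι :=
    ((PseudoEquivRel.toEquAdjunction U).comp K.asEquivalence.toAdjunction).ofNatIsoRight i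
  have hL {P Q Q' B : ExactCompletion X} (hB : PER X B) (p : P ⟶ Q) (q : P ⟶ Q') (g : Q ⟶ B)
      (g' : Q' ⟶ B) (h : IsPullback p q g g') :
      IsPullback (L.map p) (L.map q) (L.map g) (L.map g') :=
    (PseudoEquivRel.isPullback_toEqu_map U hB h).map K
  have hL' (B : (PER X).FullSubcategory) {P Q Q' : ExactCompletion X}
      {g : Q ⟶ (PER X).ι.obj B} {g' : Q' ⟶ (PER X).ι.obj B} {p : P ⟶ Q} {q : P ⟶ Q'}
      (h : IsPullback p q g g') :
      IsPullback (L.map p) (L.map q) ((adj.homEquiv Q B).symm g) ((adj.homEquiv Q' B).symm g') := by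
    refine (hL B.property p q g g' h).of_iso (Iso.refl _) (Iso.refl _) (Iso.refl _)
      (asIso (adj.counit.app B)) (by simp) (by simp) ?_ ?_
    · exact (adj.homEquiv_counit ..).symm.trans (Category.id_comp _).symm
    · exact (adj.homEquiv_counit ..).symm.trans (Category.id_comp _).symm
  refine ⟨L, adj, ?_, ?_, fun B P Q Q' g g' p q h => hL' B h⟩
  · obtain ⟨hT⟩ := PseudoEquivRel.nonempty_isTerminal_discrete (terminalIsTerminal (C := X))
    let T : (PER X).FullSubcategory :=
      ⟨_, PseudoEquivRel.per_discrete_of_isTerminal (terminalIsTerminal (C := X))⟩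
    have hT' : IsTerminal T := IsTerminal.isTerminalOfObj (PER X).ι T hT
    exact preservesFiniteProducts_of_isPullback L hT
      (hT'.ofIso (asIso (adj.counit.app T)).symm) fun P Q Q' p q g g' h => hL T.property p q g g' h
  · intro A B f P Q g p q h
    refine (hL' B h).of_iso (Iso.refl _) (Iso.refl _) (asIso (adj.counit.app A)) (Iso.refl _)
      (by simp) ?_ (by simp) ?_
    · exact (adj.homEquiv_counit ..).symm.trans (Category.id_comp _).symm
    · exact (Category.comp_id _).trans ((adj.homEquiv_counit ..).trans (adj.counit.naturality f))
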